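/- Let $d\ge 2$, let $\mathbb S=\mathbb R/\mathbb Z$ be the unit circle (angles measured in turns), and let $\sigma_d(\theta)=d\theta \bmod 1$. The image of the chord $\overline{ab}$ of the closed unit disk is $\sigma_d(\overline{ab})=\overline{\sigma_d(a)\sigma_d(b)}$; a chord may be degenerate, that is, a point of $\mathbb S$. A \emph{lamination} is a closed set of chords that pairwise do not cross inside the open disk and that contains all points of $\mathbb S$; its non-degenerate chords are its \emph{leaves}. A lamination $\mathcal L$ is \emph{$\sigma_d$-invariant} if (1) for each $\ell\in\mathcal L$, $\sigma_d(\ell)$ is in $\mathcal L$ or is a point; (2) each $\ell\in\mathcal L$ is $\sigma_d(\ell')$ for some $\ell'\in\mathcal L$; (3) for each $\ell\in\mathcal L$ such that $\sigma_d(\ell)$ is not a point there are $d$ pairwise disjoint leaves $\ell_1=\ell,\ell_2,\dots,\ell_d$ in $\mathcal L$ with $\sigma_d(\ell_i)=\sigma_d(\ell)$ for all $i$. A \emph{polygon} is the convex hull of a finite set of at least two points of $\mathbb S$, its vertices (a polygon with two vertices is a chord, which is then its only side). The polygon $P$ \emph{lies in} the lamination $\mathcal L$ if all sides of $P$ are leaves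 of $\mathcal L$ and no diagonal of $P$ is a leaf of $\mathcal L$ (so $P$ is a finite gap of $\mathcal L$, or a leaf). A set $\mathcal P$ of polygons is \emph{forward invariant} if for every $P\in\mathcal P$ no side of $P$ is mapped to a point by $\sigma_d$, and the polygon $\sigma_d(P)$ whose vertices are the images of the vertices of $P$ is in $\mathcal P$. The polygon $P$ \emph{maps forward as a positively oriented covering map} if any two vertices of $P$ that are consecutive in counterclockwise order are mapped to two distinct vertices of $\sigma_d(P)$ that are consecutive in counterclockwise order (if $\sigma_d(P)$ is a chord $\overline{xy}$, this means that the vertices of $P$ alternate between preimages of $x$ and of $y$). \textbf{Theorem.} Let $\mathcal P$ be a finite, forward invariant set of pairwise disjoint polygons. There is a $\sigma_d$-invariant lamination in which all polygons of $\mathcal P$ lie if and only if every polygon of $\mathcal P$ maps forward as a positively oriented covering map. -/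

import Mathlib

namespace Lam

open Set

/-- The circle `ℝ / ℤ`; angles are measured in turns.  Mathlib's circular order on it is the
counterclockwise one: `sbtw a b c` says that `a`, `b`, `c` are distinct and are met in this order
when the circle is traversed counterclockwise. -/
abbrev S : Type := UnitAddCircle

/-- The map `σ_d(θ) = d θ mod 1`. -/
def sigma (d : ℕ) (x : S) : S := d • x

/-- The image `σ_d(ab) = σ_d(a) σ_d(b)` of a chord.  The unordered pair `s(a, b)` stands for the
chord with endpoints `a` and `b`; the chord is a single point of the circle iff `a = b`
(`Sym2.IsDiag`). -/
def sigmaChord (d : ℕ) (l : Sym2 S) : Sym2 S := l.map (sigma d)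

/-- The chords `ab` and `ce` cross in the open disk: `c` and `e` lie in different components of the
complement of `{a, b}` in the circle. -/
def Crosses (a b c e : S) : Prop :=
  (sbtw a c b ∧ sbtw b e a) ∨ (sbtw a e b ∧ sbtw b c a)

/-- A lamination: a closed set of pairwise non-crossing chords that contains all points of the
circle.  A chord of the lamination is a leaf if it is not a point. -/
structure Lamination where
  chords : Set (Sym2 S)
  closed : IsClosed {p : S × S | s(p.1, p.2) ∈ chords}
  point_mem : ∀ x : S, s(x, x) ∈ chords
  not_crosses : ∀ a b c e : S, s(a, b) ∈ chords → s(c, e) ∈ chords → ¬ Crosses a b c e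

/-- Sibling `d`-invariant laminations.  Chords of one lamination do not cross, so two of them are
disjoint iff they have no common endpoint. -/
structure Lamination.IsInvariant (d : ℕ) (L : Lamination) : Prop where
  image_mem : ∀ l ∈ L.chords, sigmaChord d l ∈ L.chords ∨ (sigmaChord d l).IsDiag
  exists_preimage : ∀ l ∈ L.chords, ∃ l' ∈ L.chords, sigmaChord d l' = l
  exists_siblings : ∀ l ∈ L.chords, ¬ (sigmaChord d l).IsDiag →
    ∃ m : Fin d → Sym2 S, (∃ i, m i = l) ∧
      (∀ i, m i ∈ L.chords ∧ sigmaChord d (m i) = sigmaChord d l) ∧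
      ∀ i j, i ≠ j → ∀ x : S, ¬ (x ∈ m i ∧ x ∈ m j)

/-- A polygon inscribed in the circle, given by its finite set of at least two vertices
(a polygon with two vertices is a single chord). -/
structure Polygon where
  vertices : Set S
  finite : vertices.Finite
  nontrivial : vertices.Nontrivial

/-- `b` is the next point of `V` after `a` in counterclockwise order; thus `ab` is a side of the
convex hull of `V`, directed counterclockwise.  If `V = {a, b}` with `a ≠ b`, then both `(a, b)` and
`(b, a)` are directed sides. -/
def IsSide (V : Set S) (a b : S) : Prop :=
  a ∈ V ∧ b ∈ V ∧ a ≠ b ∧ ∀ c ∈ V, ¬ sbtw a c b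

/-- The convex hulls of the two vertex sets are disjoint: there is no common vertex, and no chord
between vertices of `P` crosses a chord between vertices of `Q`. -/
def Polygon.IsDisjoint (P Q : Polygon) : Prop :=
  Disjoint P.vertices Q.vertices ∧
    ∀ a ∈ P.vertices, ∀ b ∈ P.vertices, ∀ c ∈ Q.vertices, ∀ e ∈ Q.vertices, ¬ Crosses a b c e

/-- A set of polygons is forward invariant: no side of a polygon of the set is collapsed to a point,
and the image of each polygon of the set is a polygon of the set. -/
def ForwardInvariant (d : ℕ) (F : Set Polygon) : Prop :=
  ∀ P ∈ F, (∀ a b, IsSide P.vertices a b → sigma d a ≠ sigma d b) ∧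
    ∃ Q ∈ F, Q.vertices = sigma d '' P.vertices

/-- `P` maps forward as a positively oriented covering map: the boundary of `P` is mapped to the
boundary of the image polygon so that each directed side goes to a directed side, i.e. vertices that
are consecutive in counterclockwise order go to vertices that are consecutive in counterclockwise
order.  If the image has only two vertices, this says that the vertices of `P` alternate between
their preimages. -/
def Polygon.MapsAsPositiveCovering (d : ℕ) (P : Polygon) : Prop :=
  ∀ a b, IsSide P.vertices a b → IsSide (sigma d '' P.vertices) (sigma d a) (sigma d b)

/-- `P` is a polygon of the lamination `L` (a finite gap, or a single leaf if `P` has two vertices):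
its sides are leaves of `L`, and no diagonal of `P` is a leaf of `L`.  A leaf that runs through the
interior of `P` and does not cross the sides of `P` is a diagonal, so that no leaf of `L` meets the
interior of `P`. -/
def Lamination.HasPolygon (L : Lamination) (P : Polygon) : Prop :=
  ∀ a ∈ P.vertices, ∀ b ∈ P.vertices, a ≠ b →
    (s(a, b) ∈ L.chords ↔ IsSide P.vertices a b ∨ IsSide P.vertices b a)

end Lam

/-!
Forward direction. The `d` leaves over a leaf match the fibres over its two endpoints without
crossing, and counting the points of these fibres on an arc cut off by a leaf shows that two leaves
at a common point keep their orientation when their images are distinct. A side of `P` whose image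
is traversed backwards then forces the sides next to it to be mapped to the same chord, backwards
and forwards in turn; hence `P` is mapped onto a chord, for which both directions are sides.

Backward direction. Given finitely many disjoint polygons, a polygon `Q` among them, and a point `u`
over a vertex of `Q` that is not yet a vertex, the points over vertices of `Q` that no polygon
separates from `u` span a polygon that covers `Q`: a walk from one such point to the next, along the
circle and across the sides in the way, has its image on a single arc between neighbouring vertices
of `Q`, because those sides are mapped to sides. Adding such polygons again and again leads to a
family of disjoint polygons with a backward invariant set of vertices. The limits of their directed
sides generate an invariant lamination, by compactness, and no limit is a diagonal of a polygon,
because crossing is an open condition.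
-/

namespace Lam

open Set

/-! ### The circular order in counterclockwise coordinates -/

/-- The counterclockwise distance from `a` to `b`, as a number in `[0, 1)`: the coordinate of `b` on
the circle cut open at `a`. -/
noncomputable def ccw (a b : S) : ℝ := AddCircle.equivIco 1 0 (b - a)

lemma ccw_nonneg (a b : S) : 0 ≤ ccw a b := (AddCircle.equivIco 1 0 (b - a)).2.1

lemma ccw_lt_one (a b : S) : ccw a b < 1 :=
  (AddCircle.equivIco (1 : ℝ) 0 (b - a)).2.2.trans_eq (zero_add 1)

lemma coe_ccw (a b : S) : (ccw a b : S) = b - a := AddCircle.coe_equivIco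

lemma add_ccw (a b : S) : a + (ccw a b : S) = b := by rw [coe_ccw, add_sub_cancel]

lemma ccw_add_coe (a : S) (h : ℝ) : ccw a (a + (h : S)) = Int.fract h := by
  have := AddCircle.coe_equivIco_mk_apply (1 : ℝ) h
  rwa [div_one, mul_one, ← add_sub_cancel_left a (h : S)] at this

lemma ccw_add_coe_of_mem_Ico (a : S) {h : ℝ} (hh : h ∈ Ico 0 1) : ccw a (a + (h : S)) = h := by
  rw [ccw_add_coe, Int.fract_eq_self.2 hh]

lemma ccw_right_injective (o : S) : Function.Injective (ccw o) := fun a b h => by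
  rw [← add_ccw o a, ← add_ccw o b, h]

lemma eq_iff_ccw_eq (o : S) {a b : S} : a = b ↔ ccw o a = ccw o b :=
  (ccw_right_injective o).eq_iff.symm

@[simp] lemma ccw_self (a : S) : ccw a a = 0 := by
  simpa using ccw_add_coe a 0

lemma ccw_pos {a b : S} : 0 < ccw a b ↔ a ≠ b := by
  rw [(ccw_nonneg a b).lt_iff_ne, Ne, Ne, eq_iff_ccw_eq a, ccw_self]

lemma ccw_eq_fract_sub (o a b : S) : ccw a b = Int.fract (ccw o b - ccw o a) := by
  rw [← ccw_add_coe a, AddCircle.coe_sub, coe_ccw, coe_ccw, sub_sub_sub_cancel_right,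
    add_sub_cancel]

lemma ccw_eq_sub {o a b : S} (h : ccw o a ≤ ccw o b) : ccw a b = ccw o b - ccw o a := by
  rw [ccw_eq_fract_sub o, Int.fract_eq_self]
  constructor <;> linarith [ccw_nonneg o a, ccw_lt_one o b]

lemma ccw_eq_sub_add_one {o a b : S} (h : ccw o b < ccw o a) :
    ccw a b = ccw o b - ccw o a + 1 := by
  rw [ccw_eq_fract_sub o, ← Int.fract_add_one, Int.fract_eq_self]
  constructor <;> linarith [ccw_nonneg o b, ccw_lt_one o a]

lemma ccw_continuousAt {a b : S} (h : a ≠ b) :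
    ContinuousAt (fun p : S × S => ccw p.1 p.2) (a, b) := by
  have hsub : ContinuousAt (fun p : S × S => p.2 - p.1) (a, b) :=
    (continuous_snd.sub continuous_fst).continuousAt
  have hIco : ContinuousAt (AddCircle.equivIco (1 : ℝ) 0) (b - a) :=
    AddCircle.continuousAt_equivIco 1 0 (sub_ne_zero.2 h.symm)
  exact continuousAt_subtype_val.comp (hIco.comp (x := (a, b)) hsub)

lemma btw_iff_ccw_le {a b c : S} : btw a b c ↔ ccw a b ≤ ccw a c ∨ a = c := by
  change ccw a b ≤ (QuotientAddGroup.equivIocMod (zero_lt_one' ℝ) 0 (c - a) : ℝ) ↔ _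
  by_cases hac : a = c
  · have : (QuotientAddGroup.equivIocMod (zero_lt_one' ℝ) 0 (0 : S) : ℝ) = 1 := by
      simp [QuotientAddGroup.equivIocMod_zero]
    rw [hac, sub_self, this]
    simp [(ccw_lt_one c b).le]
  · have : toIocMod (zero_lt_one' ℝ) 0 (ccw a c) = ccw a c :=
      (toIocMod_eq_self _).2 ⟨ccw_pos.2 hac, (ccw_lt_one a c).le.trans_eq (zero_add 1).symm⟩
    rw [← coe_ccw a c]
    change ccw a b ≤ toIocMod (zero_lt_one' ℝ) 0 (ccw a c) ↔ _
    rw [this, or_iff_left hac]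

lemma sbtw_iff_ccw_lt {a b c : S} : sbtw a b c ↔ 0 < ccw c a ∧ ccw c a < ccw c b := by
  rw [sbtw_iff_not_btw, btw_iff_ccw_le, not_or, not_le, ccw_pos, and_comm]

lemma sbtw_iff_ccw (o : S) {a b c : S} : sbtw a b c ↔
    (ccw o a < ccw o b ∧ ccw o b < ccw o c) ∨ (ccw o b < ccw o c ∧ ccw o c < ccw o a) ∨
      (ccw o c < ccw o a ∧ ccw o a < ccw o b) := by
  rw [sbtw_iff_ccw_lt]
  have ha := ccw_lt_one o a
  have hb := ccw_lt_one o b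
  have ha' := ccw_nonneg o a
  have hb' := ccw_nonneg o b
  have hc := ccw_lt_one o c
  rcases le_or_gt (ccw o c) (ccw o a) with hca | hca <;>
    rcases le_or_gt (ccw o c) (ccw o b) with hcb | hcb <;>
    first | rw [ccw_eq_sub hca] | rw [ccw_eq_sub_add_one hca]
  all_goals first | rw [ccw_eq_sub hcb] | rw [ccw_eq_sub_add_one hcb]
  all_goals grind

lemma sbtw_iff_ccw_left {a b c : S} : sbtw a b c ↔ 0 < ccw a b ∧ ccw a b < ccw a c := by
  rw [sbtw_cyclic, sbtw_cyclic, sbtw_iff_ccw a, ccw_self]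
  grind [ccw_nonneg]

lemma sbtw_or_sbtw {α : Type*} [CircularOrder α] {a b c : α} (hab : a ≠ b) (hbc : b ≠ c)
    (hca : c ≠ a) : sbtw a b c ∨ sbtw c b a := by
  by_contra! h
  rw [← btw_iff_not_sbtw, ← btw_iff_not_sbtw] at h
  rcases h.2.antisymm h.1 with h | h | h <;> contradiction

lemma isOpen_sbtw : IsOpen {p : S × S × S | sbtw p.1 p.2.1 p.2.2} := by
  rw [isOpen_iff_mem_nhds]
  rintro ⟨a, b, c⟩ (h : sbtw a b c)
  rw [sbtw_iff_ccw_left] at h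
  have hab : ContinuousAt (fun p : S × S × S => ccw p.1 p.2.1) (a, b, c) :=
    ContinuousAt.comp (f := fun p : S × S × S => (p.1, p.2.1)) (ccw_continuousAt (ccw_pos.1 h.1))
      (by fun_prop)
  have hac : ContinuousAt (fun p : S × S × S => ccw p.1 p.2.2) (a, b, c) :=
    ContinuousAt.comp (f := fun p : S × S × S => (p.1, p.2.2))
      (ccw_continuousAt (ccw_pos.1 (h.1.trans h.2))) (by fun_prop)
  filter_upwards [hab.eventually (lt_mem_nhds h.1), hab.eventually_lt hac h.2] with p hp hp'
  exact sbtw_iff_ccw_left.2 ⟨hp, hp'⟩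

/-- The half-open arc `(x, y]`, traversed counterclockwise; it is empty if `x = y`. -/
def arcIoc (x y : S) : Set S := {p | 0 < ccw x p ∧ ccw x p ≤ ccw x y}

/-- The half-open arc `[x, y)`, traversed counterclockwise; it is empty if `x = y`. -/
def arcIco (x y : S) : Set S := {p | ccw x p < ccw x y}

lemma ne_of_sbtw {α : Type*} [CircularPreorder α] {a b c : α} (h : sbtw a b c) :
    a ≠ b ∧ b ≠ c ∧ a ≠ c :=
  ⟨fun hab => sbtw_irrefl_left (hab ▸ h), fun hbc => sbtw_irrefl_right (hbc ▸ h),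
    fun hac => sbtw_irrefl_left_right (hac ▸ h)⟩

lemma Crosses.swap_left {a b c e : S} (h : Crosses a b c e) : Crosses b a c e :=
  (h.imp And.symm And.symm).symm

lemma Crosses.swap_right {a b c e : S} (h : Crosses a b c e) : Crosses a b e c := Or.symm h

lemma Crosses.symm {a b c e : S} (h : Crosses a b c e) : Crosses c e a b := by
  simp only [Crosses, sbtw_iff_ccw 0] at *
  grind

lemma isOpen_crosses : IsOpen {p : (S × S) × (S × S) | Crosses p.1.1 p.1.2 p.2.1 p.2.2} := by
  have isOpen_sbtw_comp : ∀ {f g h : (S × S) × (S × S) → S}, Continuous f → Continuous g →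
      Continuous h → IsOpen {p | sbtw (f p) (g p) (h p)} := fun hf hg hh =>
    isOpen_sbtw.preimage (hf.prodMk (hg.prodMk hh))
  refine IsOpen.union (IsOpen.inter ?_ ?_) (IsOpen.inter ?_ ?_) <;>
    exact isOpen_sbtw_comp (by fun_prop) (by fun_prop) (by fun_prop)

/-! ### The map `sigma` and its fibres -/

section Sigma

variable {d : ℕ}

lemma continuous_sigma (d : ℕ) : Continuous (sigma d) := continuous_nsmul d

lemma sigma_add_coe (d : ℕ) (a : S) (h : ℝ) :
    sigma d (a + (h : S)) = sigma d a + ((d * h : ℝ) : S) := by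
  rw [sigma, smul_add, ← AddCircle.coe_nsmul, nsmul_eq_mul, sigma]

lemma ccw_sigma (d : ℕ) (a b : S) : ccw (sigma d a) (sigma d b) = Int.fract (d * ccw a b) := by
  rw [← ccw_add_coe (sigma d a), ← sigma_add_coe, add_ccw]

lemma sigma_surjective (hd : 0 < d) : Function.Surjective (sigma d) := fun a => by
  refine ⟨((ccw 0 a / d : ℝ) : S), ?_⟩
  rw [sigma, ← AddCircle.coe_nsmul, nsmul_eq_mul, mul_div_cancel₀ _ (by positivity), coe_ccw,
    sub_zero]

lemma sigma_fiber_eq_range (hd : 0 < d) (a : S) :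
    {w | sigma d w = sigma d a} = range fun k : Fin d => a + (((k : ℝ) / d : ℝ) : S) := by
  ext w
  rw [mem_ofPred_eq, sigma, sigma, ← sub_eq_zero, ← smul_sub, AddCircle.nsmul_eq_zero_iff hd]
  simp only [mul_one, eq_sub_iff_add_eq', mem_range, Fin.exists_iff, exists_prop]

lemma add_div_injective (d : ℕ) (a : S) :
    Function.Injective fun k : Fin d => a + (((k : ℝ) / d : ℝ) : S) := by
  intro k l h
  have mem_Ico : ∀ k : Fin d, (k / d : ℝ) ∈ Ico (0 : ℝ) 1 := fun k =>
    ⟨by positivity, (div_lt_one (by exact_mod_cast k.pos)).2 (by exact_mod_cast k.2)⟩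
  have hkl := congrArg (ccw a) h
  simp only [ccw_add_coe_of_mem_Ico, mem_Ico] at hkl
  rw [div_left_inj' (by exact_mod_cast k.pos.ne')] at hkl
  exact Fin.ext (by exact_mod_cast hkl)

lemma finite_sigma_fiber (hd : 0 < d) (x : S) : {w | sigma d w = x}.Finite := by
  obtain ⟨a, rfl⟩ := sigma_surjective hd x
  exact sigma_fiber_eq_range hd a ▸ finite_range _

/-- `v` enumerates a fibre of `sigma d`: `d` distinct points with the same image. -/
structure IsFiber (d : ℕ) (v : Fin d → S) : Prop where
  sigma_eq : ∀ k l, sigma d (v k) = sigma d (v l)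
  injective : Function.Injective v

lemma exists_isFiber (hd : 0 < d) (a : S) : ∃ v, IsFiber d v ∧ a ∈ range v := by
  have range_eq := sigma_fiber_eq_range hd a
  refine ⟨_, ⟨fun k l => ?_, add_div_injective d a⟩, range_eq ▸ rfl⟩
  exact ((range_eq ▸ mem_range_self k :) : _ ∈ {w | sigma d w = sigma d a}).trans
    ((range_eq ▸ mem_range_self l :) : _ ∈ {w | sigma d w = sigma d a}).symm

lemma IsFiber.range_eq {v : Fin d → S} (hv : IsFiber d v) (k : Fin d) :
    range v = {w | sigma d w = sigma d (v k)} := by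
  refine eq_of_subset_of_ncard_le (range_subset_iff.2 fun l => hv.sigma_eq l k) ?_
    (finite_sigma_fiber k.pos _)
  rw [sigma_fiber_eq_range k.pos, ← image_univ, ← image_univ,
    ncard_image_of_injective _ (add_div_injective d _), ncard_image_of_injective _ hv.injective]

-- Distinct points of a fibre stay apart: their differences lie in a finite set that misses `0`.
lemma isClosed_isFiber (hd : 0 < d) : IsClosed {v | IsFiber d v} := by
  have isFiber_iff : ∀ v, IsFiber d v ↔
      ∀ k l, k ≠ l → v k - v l ∈ {u : S | sigma d u = 0} \ {0} := fun v => by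
    have sub_mem : ∀ k l, v k - v l ∈ {u : S | sigma d u = 0} \ {0} ↔
        sigma d (v k) = sigma d (v l) ∧ v k ≠ v l := fun k l => by
      simp [sigma, smul_sub, sub_eq_zero]
    simp only [sub_mem]
    exact ⟨fun h k l hkl => ⟨h.sigma_eq k l, h.injective.ne hkl⟩, fun h =>
      ⟨fun k l => (eq_or_ne k l).elim (fun hkl => hkl ▸ rfl) fun hkl => (h k l hkl).1,
        fun k l => not_imp_not.1 fun hkl => (h k l hkl).2⟩⟩
  simp only [isFiber_iff, ofPred_forall]
  refine isClosed_iInter fun k => isClosed_iInter fun l => isClosed_iInter fun _ => ?_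
  exact ((finite_sigma_fiber hd 0).subset sdiff_subset).isClosed.preimage
    ((continuous_apply k).sub (continuous_apply l))

end Sigma

/-! ### Sides of finite sets of points -/

section IsSide

variable {V : Set S} {a b c : S}

lemma IsSide.eq_of_mem_arcIoc (h : IsSide V a b) (hc : c ∈ V) (hcb : c ∈ arcIoc a b) : c = b :=
  (eq_iff_ccw_eq a).2 <| hcb.2.eq_of_not_lt fun hlt =>
    h.2.2.2 c hc (sbtw_iff_ccw_left.2 ⟨hcb.1, hlt⟩)

lemma IsSide.eq_of_mem_arcIco (h : IsSide V a b) (hc : c ∈ V) (hcb : c ∈ arcIco a b) : c = a :=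
  not_imp_comm.1 (fun hca => ccw_pos.2 (Ne.symm hca)) fun hpos =>
    h.2.2.2 c hc (sbtw_iff_ccw_left.2 ⟨hpos, hcb⟩)

lemma IsSide.right_unique (h : IsSide V a b) (h' : IsSide V a c) : b = c :=
  (le_total (ccw a b) (ccw a c)).elim
    (fun hle => h'.eq_of_mem_arcIoc h.2.1 ⟨ccw_pos.2 h.2.2.1, hle⟩)
    fun hle => (h.eq_of_mem_arcIoc h'.2.1 ⟨ccw_pos.2 h'.2.2.1, hle⟩).symm

lemma IsSide.left_unique (h : IsSide V a c) (h' : IsSide V b c) : a = b := by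
  by_contra hab
  rcases sbtw_or_sbtw hab h'.2.2.1 h.2.2.1.symm with hs | hs
  · exact h.2.2.2 b h'.1 hs
  · exact h'.2.2.2 a h.1 (sbtw_cyclic_left hs)

lemma IsSide.sbtw (h : IsSide V a b) (h' : IsSide V b c) (hac : a ≠ c) : sbtw a b c :=
  (sbtw_or_sbtw h.2.2.1 h'.2.2.1 hac.symm).resolve_right fun hs =>
    h.2.2.2 c h'.2.1 (sbtw_cyclic_right hs)

lemma exists_isSide (hV : V.Finite) (hn : V.Nontrivial) (ha : a ∈ V) : ∃ b, IsSide V a b := by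
  obtain ⟨b, ⟨hb, hba⟩, hmin⟩ := (V \ {a}).exists_min_image (ccw a) (hV.subset sdiff_subset)
    (hn.exists_ne a)
  refine ⟨b, ha, hb, Ne.symm hba, fun c hc hs => ?_⟩
  exact (hmin c ⟨hc, (ne_of_sbtw hs).1.symm⟩).not_gt (sbtw_iff_ccw_left.1 hs).2

lemma exists_isSide_sbtw (hV : V.Finite) (hn : V.Nontrivial) {g : S} (hg : g ∉ V) :
    ∃ p q, IsSide V p q ∧ sbtw p g q := by
  obtain ⟨p, hp, hmin⟩ := V.exists_min_image (fun a => ccw a g) hV hn.nonempty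
  obtain ⟨q, hq⟩ := exists_isSide hV hn hp
  refine ⟨p, q, hq, sbtw_iff_ccw_left.2 ⟨ccw_pos.2 fun hpg => hg (hpg ▸ hp), ?_⟩⟩
  by_contra! hle
  have hqg : ccw p g ≤ ccw q g := hmin q hq.2.1
  linarith [ccw_eq_sub hle, ccw_pos.2 hq.2.2.1]

lemma subset_of_isSide_closed {A : Set S} (hV : V.Finite) (hn : V.Nontrivial)
    (hA : A ⊆ V) (hne : A.Nonempty) (hclosed : ∀ a b, a ∈ A → IsSide V a b → b ∈ A) : V ⊆ A := by
  intro p hp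
  by_contra hpA
  obtain ⟨a, ha, hmin⟩ := A.exists_min_image (fun a => ccw a p) (hV.subset hA) hne
  obtain ⟨b, hb⟩ := exists_isSide hV hn (hA ha)
  have hle : ccw a b ≤ ccw a p := by
    by_contra! hlt
    exact hpA (hb.eq_of_mem_arcIco hp hlt ▸ ha)
  have hmin_b : ccw a p ≤ ccw b p := hmin b (hclosed a b ha hb)
  linarith [ccw_eq_sub hle, ccw_pos.2 hb.2.2.1]

end IsSide

/-! ### Polygons of invariant laminations -/

lemma ccw_sigma_le (d : ℕ) (a b : S) : ccw (sigma d a) (sigma d b) ≤ d * ccw a b := by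
  have floor_nonneg : (0 : ℝ) ≤ ⌊d * ccw a b⌋ :=
    Int.cast_nonneg (Int.floor_nonneg.2 (mul_nonneg d.cast_nonneg (ccw_nonneg a b)))
  rw [ccw_sigma, Int.fract]
  linarith

lemma add_coe_mem_arcIoc {d : ℕ} {u v w : S} {t : ℝ} (hw : sigma d w = sigma d u)
    (hwv : w ∈ arcIco u v) (ht : 0 < t) (htv : d * t ≤ ccw (sigma d u) (sigma d v)) (hd : 0 < d) :
    w + (t : S) ∈ arcIoc u v := by
  have ccw_w_v : ccw w v = ccw u v - ccw u w := ccw_eq_sub hwv.le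
  have htw : t ≤ ccw w v := by
    refine le_of_mul_le_mul_left (htv.trans ?_) (Nat.cast_pos.2 hd)
    exact hw ▸ ccw_sigma_le d w v
  have ccw_add : ccw u (w + (t : S)) = ccw u w + t := by
    rw [← add_ccw u w, add_assoc, ← AddCircle.coe_add, add_ccw]
    exact ccw_add_coe_of_mem_Ico u
      ⟨by linarith [ccw_nonneg u w], by linarith [ccw_lt_one u v]⟩
  constructor <;> linarith [ccw_nonneg u w]

lemma IsFiber.ncard_arcIco_le_ncard_arcIoc {d : ℕ} {p q : Fin d → S} (hp : IsFiber d p)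
    (hq : IsFiber d q) {i₀ : Fin d} {v : S}
    (h : sigma d (p i₀) ∈ arcIoc (sigma d (q i₀)) (sigma d v)) :
    {i | q i ∈ arcIco (q i₀) v}.ncard ≤ {i | p i ∈ arcIoc (q i₀) v}.ncard := by
  have hd : (0 : ℝ) < d := Nat.cast_pos.2 i₀.pos
  set δ : ℝ := ccw (sigma d (q i₀)) (sigma d (p i₀)) / d
  have d_mul_δ : d * δ = ccw (sigma d (q i₀)) (sigma d (p i₀)) := mul_div_cancel₀ _ hd.ne'
  have exists_shift : ∀ i, ∃ j, p j = q i + (δ : S) := fun i => by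
    have : q i + (δ : S) ∈ range p := by
      rw [hp.range_eq i₀, mem_ofPred_eq, sigma_add_coe, d_mul_δ, hq.sigma_eq i i₀, add_ccw]
    exact this
  choose shift p_shift using exists_shift
  refine ncard_le_ncard_of_injOn shift (fun i hi => ?_) fun i _ j _ hij => ?_
  · change p (shift i) ∈ arcIoc (q i₀) v
    exact p_shift i ▸ add_coe_mem_arcIoc (hq.sigma_eq i i₀) hi (div_pos h.1 hd)
      (d_mul_δ.trans_le h.2) i₀.pos
  · exact hq.injective (add_right_cancel ((p_shift i).symm.trans (hij ▸ p_shift j)))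

namespace Lamination

/-- The leaves `p i q i` of `L` match two fibres of `sigma d`; this is what the sibling condition
provides. -/
structure IsMatching (d : ℕ) (L : Lamination) (p q : Fin d → S) : Prop where
  isFiber_left : IsFiber d p
  isFiber_right : IsFiber d q
  mem_chords : ∀ i, s(p i, q i) ∈ L.chords

variable {d : ℕ} {L : Lamination}

lemma mem_chords_comm {a b : S} : s(a, b) ∈ L.chords ↔ s(b, a) ∈ L.chords := by
  rw [Sym2.eq_swap]

lemma IsInvariant.exists_matching (hL : L.IsInvariant d) {a b : S} (hab : s(a, b) ∈ L.chords)
    (hne : sigma d a ≠ sigma d b) :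
    ∃ p q, L.IsMatching d p q ∧ ∃ i, p i = a ∧ q i = b := by
  obtain ⟨m, ⟨i, hi⟩, hm, hdisj⟩ := hL.exists_siblings _ hab (by simpa [sigmaChord] using hne)
  have exists_endpoints : ∀ i, ∃ p q, m i = s(p, q) ∧ sigma d p = sigma d a ∧
      sigma d q = sigma d b := by
    intro i
    obtain ⟨p, q, hpq⟩ : ∃ p q, m i = s(p, q) := Sym2.exists.1 ⟨m i, rfl⟩
    have hσ : s(sigma d p, sigma d q) = s(sigma d a, sigma d b) := by
      simpa [hpq, sigmaChord] using (hm i).2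
    rcases Sym2.eq_iff.1 hσ with ⟨ha, hb⟩ | ⟨hb, ha⟩
    · exact ⟨p, q, hpq, ha, hb⟩
    · exact ⟨q, p, hpq.trans Sym2.eq_swap, ha, hb⟩
  choose p q hmpq hp hq using exists_endpoints
  have eq_of_mem : ∀ {i j x}, x ∈ m i → x ∈ m j → i = j := fun {i j x} hxi hxj =>
    by_contra fun hij => hdisj i j hij x ⟨hxi, hxj⟩
  have hpi : p i = a ∧ q i = b := by
    rcases Sym2.eq_iff.1 ((hmpq i).symm.trans hi) with h | h
    · exact h
    · exact absurd (h.2 ▸ hq i) hne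
  refine ⟨p, q, ⟨⟨fun k l => (hp k).trans (hp l).symm, fun k l h => ?_⟩,
    ⟨fun k l => (hq k).trans (hq l).symm, fun k l h => ?_⟩, fun k => hmpq k ▸ (hm k).1⟩, i, hpi⟩
  · exact eq_of_mem (x := p k) (by simp [hmpq k]) (by simp [hmpq l, h])
  · exact eq_of_mem (x := q k) (by simp [hmpq k]) (by simp [hmpq l, h])

-- If every point `p i` on the arc `(u, v]` were matched with a point on `[u, v)`, then, as `u` is
-- matched with a point off the arc, `[u, v)` would contain more of the `q i` than `(u, v]` contains
-- of the `p i`.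
lemma IsMatching.exists_eq_of_notMem_arcIoc {p q : Fin d → S} (hpq : L.IsMatching d p q)
    {i₀ : Fin d} {v : S} (hv : s(q i₀, v) ∈ L.chords)
    (h : sigma d (p i₀) ∈ arcIoc (sigma d (q i₀)) (sigma d v)) (hp : p i₀ ∉ arcIoc (q i₀) v) :
    ∃ i, p i = v ∧ q i ∉ arcIco (q i₀) v := by
  have sigma_ne : sigma d (q i₀) ≠ sigma d v := ccw_pos.1 (h.1.trans_le h.2)
  obtain ⟨i, hpi, hqi⟩ : ∃ i, p i ∈ arcIoc (q i₀) v ∧ q i ∉ arcIco (q i₀) v := by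
    by_contra! hall
    refine (hpq.isFiber_left.ncard_arcIco_le_ncard_arcIoc hpq.isFiber_right h).not_gt ?_
    refine ncard_lt_ncard ⟨hall, fun hsub => hp (hsub (a := i₀) ?_)⟩
    exact (ccw_self _).trans_lt (ccw_pos.2 fun huv => sigma_ne (huv ▸ rfl))
  have hqi_ne : q i ≠ v := fun hqv => sigma_ne (hqv ▸ hpq.isFiber_right.sigma_eq i₀ i)
  have hqi_gt : ccw (q i₀) v < ccw (q i₀) (q i) :=
    (not_lt.1 hqi).lt_of_ne fun heq => hqi_ne (ccw_right_injective _ heq).symm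
  refine ⟨i, by_contra fun hne => ?_, hqi⟩
  refine L.not_crosses (q i₀) v (p i) (q i) hv (hpq.mem_chords i) (Or.inl ⟨?_, ?_⟩)
  · exact sbtw_iff_ccw_left.2 ⟨hpi.1, hpi.2.lt_of_ne fun heq => hne (ccw_right_injective _ heq)⟩
  · exact sbtw_cyclic_left (sbtw_iff_ccw_left.2 ⟨hpi.1.trans_le hpi.2, hqi_gt⟩)

lemma IsInvariant.sbtw_of_sbtw_sigma (hL : L.IsInvariant d) {a b c : S} (hab : s(a, b) ∈ L.chords)
    (hbc : s(b, c) ∈ L.chords) (h : sbtw (sigma d a) (sigma d b) (sigma d c)) : sbtw a b c := by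
  obtain ⟨-, hbc_ne, hac_ne⟩ := ne_of_sbtw h
  obtain ⟨p, q, hpq, i, rfl, rfl⟩ := hL.exists_matching (mem_chords_comm.1 hbc) hbc_ne.symm
  have hσ := sbtw_iff_ccw_left.1 (sbtw_cyclic_left h)
  have mem_arc : p i ∈ arcIoc (q i) a := by
    by_contra hp
    obtain ⟨j, rfl, -⟩ :=
      hpq.exists_eq_of_notMem_arcIoc (mem_chords_comm.1 hab) ⟨hσ.1, hσ.2.le⟩ hp
    exact hac_ne (hpq.isFiber_left.sigma_eq j i)
  refine sbtw_cyclic_right (sbtw_iff_ccw_left.2 ⟨mem_arc.1, mem_arc.2.lt_of_ne fun heq => ?_⟩)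
  exact hac_ne (ccw_right_injective _ heq ▸ rfl)

lemma IsInvariant.exists_leaf_notMem_arcIco (hL : L.IsInvariant d) {b c c' : S}
    (hbc : s(b, c) ∈ L.chords) (hcc' : s(c, c') ∈ L.chords) (hne : sigma d b ≠ sigma d c)
    (heq : sigma d c' = sigma d b) (h : sbtw b c c') :
    ∃ w, s(c', w) ∈ L.chords ∧ sigma d w = sigma d c ∧ w ∉ arcIco c c' := by
  obtain ⟨p, q, hpq, i, rfl, rfl⟩ := hL.exists_matching hbc hne
  obtain ⟨j, rfl, hj⟩ := hpq.exists_eq_of_notMem_arcIoc hcc'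
    ⟨ccw_pos.2 hne.symm, by rw [heq]⟩
    fun hp => hp.2.not_gt (sbtw_iff_ccw_left.1 (sbtw_cyclic_left h)).2
  exact ⟨q j, hpq.mem_chords j, hpq.isFiber_right.sigma_eq j i, hj⟩

namespace HasPolygon

variable {P Q : Polygon}

lemma mem_chords_of_isSide (hP : L.HasPolygon P) {a b : S} (h : IsSide P.vertices a b) :
    s(a, b) ∈ L.chords :=
  (hP a h.1 b h.2.1 h.2.2.1).2 (Or.inl h)

lemma not_sbtw_of_mem_chords (hP : L.HasPolygon P) {b c e w : S} (hbc : IsSide P.vertices b c)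
    (hce : IsSide P.vertices c e) (hw : s(c, w) ∈ L.chords) : ¬ sbtw e w b := by
  intro hs
  have hbce : sbtw b c e := hbc.sbtw hce (ne_of_sbtw hs).2.2.symm
  have hcwe : ¬ sbtw c w e ∧ ¬ sbtw b w c ∧ w ≠ c := by
    simp only [sbtw_iff_ccw 0, Ne, eq_iff_ccw_eq 0] at *
    grind
  by_cases hwP : w ∈ P.vertices
  · rcases (hP c hbc.2.1 w hwP hcwe.2.2.symm).1 hw with hcw | hwc
    · exact (ne_of_sbtw hs).1 (hce.right_unique hcw)
    · exact (ne_of_sbtw hs).2.1 (hwc.left_unique hbc)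
  · obtain ⟨p, q, hpq, hpwq⟩ := exists_isSide_sbtw P.finite P.nontrivial hwP
    have hpc : p ≠ c := by
      rintro rfl
      exact hcwe.1 (hpq.right_unique hce ▸ hpwq)
    have hqc : q ≠ c := by
      rintro rfl
      exact hcwe.2.1 (hpq.left_unique hbc ▸ hpwq)
    have hqcp : sbtw q c p :=
      (sbtw_or_sbtw hpc hqc.symm hpq.2.2.1.symm).resolve_left (hpq.2.2.2 c hbc.2.1)
    exact L.not_crosses p q w c (hP.mem_chords_of_isSide hpq) (mem_chords_comm.1 hw)
      (Or.inl ⟨hpwq, hqcp⟩)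

lemma isSide_sigma_or (hP : L.HasPolygon P) (hQ : L.HasPolygon Q) (hL : L.IsInvariant d)
    (hPQ : Q.vertices = sigma d '' P.vertices) {a b : S} (h : IsSide P.vertices a b)
    (hne : sigma d a ≠ sigma d b) :
    IsSide Q.vertices (sigma d a) (sigma d b) ∨ IsSide Q.vertices (sigma d b) (sigma d a) := by
  refine (hQ _ (hPQ ▸ mem_image_of_mem _ h.1) _ (hPQ ▸ mem_image_of_mem _ h.2.1) hne).1 ?_
  simpa [sigmaChord, hne] using hL.image_mem _ (hP.mem_chords_of_isSide h)

lemma sigma_eq_of_isSide_swap (hP : L.HasPolygon P) (hQ : L.HasPolygon Q) (hL : L.IsInvariant d)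
    (hPQ : Q.vertices = sigma d '' P.vertices) {b c c' : S} (hbc : IsSide P.vertices b c)
    (hcc' : IsSide P.vertices c c') (hne : sigma d c ≠ sigma d c')
    (h : IsSide Q.vertices (sigma d c) (sigma d b)) : sigma d c' = sigma d b := by
  rcases isSide_sigma_or hP hQ hL hPQ hcc' hne with hσ | hσ
  · exact hσ.right_unique h
  · by_contra hne'
    have hs : sbtw c' c b := hL.sbtw_of_sbtw_sigma
      (mem_chords_comm.1 (hP.mem_chords_of_isSide hcc'))
      (mem_chords_comm.1 (hP.mem_chords_of_isSide hbc)) (hσ.sbtw h hne')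
    exact sbtw_asymm hs (hbc.sbtw hcc' fun hbc' => hne' (hbc' ▸ rfl))

-- Otherwise the leaf at `c'` that lies over the image of `bc` would run through `P`.
lemma sigma_eq_of_isSide_swap_of_sigma_eq (hP : L.HasPolygon P) (hQ : L.HasPolygon Q)
    (hL : L.IsInvariant d) (hPQ : Q.vertices = sigma d '' P.vertices) {b c c' e : S}
    (hbc : IsSide P.vertices b c) (hcc' : IsSide P.vertices c c') (hc'e : IsSide P.vertices c' e)
    (hne : sigma d c' ≠ sigma d e) (h : IsSide Q.vertices (sigma d c) (sigma d b))
    (hc' : sigma d c' = sigma d b) : sigma d e = sigma d c := by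
  rcases isSide_sigma_or hP hQ hL hPQ hc'e hne with hσ | hσ
  swap
  · exact (hc' ▸ hσ).left_unique h
  by_contra hec
  have hbc' : b ≠ c' := by
    rintro rfl
    exact hec (hc'e.right_unique hbc ▸ rfl)
  obtain ⟨w, hw, hwc, hw_arc⟩ := hL.exists_leaf_notMem_arcIco (hP.mem_chords_of_isSide hbc)
    (hP.mem_chords_of_isSide hcc') h.2.2.1.symm hc' (hbc.sbtw hcc' hbc')
  have hwc'e : sbtw w c' e := by
    refine hL.sbtw_of_sbtw_sigma (mem_chords_comm.1 hw) (hP.mem_chords_of_isSide hc'e) ?_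
    rw [hwc, hc']
    exact h.sbtw (hc' ▸ hσ) (Ne.symm hec)
  have hcc'e : sbtw c c' e := hcc'.sbtw hc'e fun hce => hec (hce ▸ rfl)
  refine not_sbtw_of_mem_chords hP hcc' hc'e hw ?_
  simp only [arcIco, mem_ofPred_eq, sbtw_iff_ccw c, ccw_self] at *
  grind [ccw_nonneg]

lemma sigma_eq_or_of_isSide_swap (hP : L.HasPolygon P) (hQ : L.HasPolygon Q)
    (hL : L.IsInvariant d) (hPQ : Q.vertices = sigma d '' P.vertices)
    (hside : ∀ a b, IsSide P.vertices a b → sigma d a ≠ sigma d b) {b c v : S}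
    (hbc : IsSide P.vertices b c) (h : IsSide Q.vertices (sigma d c) (sigma d b))
    (hv : v ∈ P.vertices) : sigma d v = sigma d b ∨ sigma d v = sigma d c := by
  let A : Set S := {v | ∃ p q, IsSide P.vertices p q ∧ sigma d p = sigma d b ∧
    sigma d q = sigma d c ∧ (v = p ∨ v = q)}
  suffices hA : P.vertices ⊆ A by
    obtain ⟨p, q, -, hp, hq, rfl | rfl⟩ := hA hv
    exacts [.inl hp, .inr hq]
  refine subset_of_isSide_closed P.finite P.nontrivial ?_ ⟨b, b, c, hbc, rfl, rfl, .inl rfl⟩ ?_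
  · rintro v ⟨p, q, hpq, -, -, rfl | rfl⟩
    exacts [hpq.1, hpq.2.1]
  · rintro v v' ⟨p, q, hpq, hp, hq, rfl | rfl⟩ hvv'
    · exact ⟨v, q, hpq, hp, hq, .inr (hvv'.right_unique hpq)⟩
    · obtain ⟨e, he⟩ := exists_isSide P.finite P.nontrivial hvv'.2.1
      rw [← hp, ← hq] at h
      have hv' := sigma_eq_of_isSide_swap hP hQ hL hPQ hpq hvv' (hside _ _ hvv') h
      have hσe := sigma_eq_of_isSide_swap_of_sigma_eq hP hQ hL hPQ hpq hvv' he (hside _ _ he) h hv'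
      exact ⟨v', e, he, hv'.trans hp, hσe.trans hq, .inl rfl⟩

theorem mapsAsPositiveCovering (hP : L.HasPolygon P) (hQ : L.HasPolygon Q) (hL : L.IsInvariant d)
    (hPQ : Q.vertices = sigma d '' P.vertices)
    (hside : ∀ a b, IsSide P.vertices a b → sigma d a ≠ sigma d b) :
    P.MapsAsPositiveCovering d := by
  intro b c hbc
  rcases isSide_sigma_or hP hQ hL hPQ hbc (hside _ _ hbc) with h | h
  · exact hPQ ▸ h
  refine ⟨mem_image_of_mem _ hbc.1, mem_image_of_mem _ hbc.2.1, hside _ _ hbc, ?_⟩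
  rintro _ ⟨v, hv, rfl⟩ hs
  rcases sigma_eq_or_of_isSide_swap hP hQ hL hPQ hside hbc h hv with hvb | hvc
  · exact (ne_of_sbtw hs).1 hvb.symm
  · exact (ne_of_sbtw hs).2.1 hvc

end HasPolygon

end Lamination

/-! ### Points seen from a point past a set of polygons -/

section Sees

variable {𝓐 : Set Polygon} {u v w : S}

/-- The vertices of the polygons of `𝓐`. -/
def vertexSet (𝓐 : Set Polygon) : Set S := ⋃ A ∈ 𝓐, A.vertices

lemma mem_vertexSet : u ∈ vertexSet 𝓐 ↔ ∃ A ∈ 𝓐, u ∈ A.vertices := by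
  simp only [vertexSet, mem_iUnion, exists_prop]

lemma vertexSet_mono {𝓑 : Set Polygon} (h : 𝓐 ⊆ 𝓑) : vertexSet 𝓐 ⊆ vertexSet 𝓑 :=
  biUnion_mono h fun _ _ => Subset.rfl

instance : Std.Symm Polygon.IsDisjoint where
  symm _ _ h := ⟨h.1.symm, fun a ha b hb c hc e he hx => h.2 c hc e he a ha b hb hx.symm⟩

/-- `w` is seen from `u` past the polygons of `𝓐`: both are off these polygons, and none of the
polygons separates them. -/
def Sees (𝓐 : Set Polygon) (u w : S) : Prop :=
  u ∉ vertexSet 𝓐 ∧ w ∉ vertexSet 𝓐 ∧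
    ∀ A ∈ 𝓐, ∀ a ∈ A.vertices, ∀ b ∈ A.vertices, ¬ Crosses a b u w

lemma Sees.refl (hu : u ∉ vertexSet 𝓐) : Sees 𝓐 u u :=
  ⟨hu, hu, fun _ _ _ _ _ _ h => h.elim (fun h => sbtw_asymm h.1 h.2) fun h => sbtw_asymm h.1 h.2⟩

lemma Sees.symm (h : Sees 𝓐 u w) : Sees 𝓐 w u :=
  ⟨h.2.1, h.1, fun A hA a ha b hb hx => h.2.2 A hA a ha b hb hx.swap_right⟩

lemma Crosses.or_of_ne {a b : S} (h : Crosses a b u w) (ha : v ≠ a) (hb : v ≠ b) :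
    Crosses a b u v ∨ Crosses a b v w := by
  simp only [Crosses, sbtw_iff_ccw 0, Ne, eq_iff_ccw_eq 0] at *
  grind

lemma Sees.trans (huv : Sees 𝓐 u v) (hvw : Sees 𝓐 v w) : Sees 𝓐 u w := by
  refine ⟨huv.1, hvw.2.1, fun A hA a ha b hb hx => ?_⟩
  have ne_vertex : ∀ a ∈ A.vertices, v ≠ a := fun a ha hva =>
    hvw.1 (mem_vertexSet.2 ⟨A, hA, hva ▸ ha⟩)
  rcases hx.or_of_ne (ne_vertex a ha) (ne_vertex b hb) with hx | hx
  exacts [huv.2.2 A hA a ha b hb hx, hvw.2.2 A hA a ha b hb hx]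

/-- No polygon of `𝓐` has vertices on both sides of the cut from `u` to `u + T`, that is, both at
counterclockwise distance less than `T` from `u` and at distance at least `T`. -/
def IsCut (𝓐 : Set Polygon) (u : S) (T : ℝ) : Prop :=
  ∀ A ∈ 𝓐, ∀ a ∈ A.vertices, ∀ b ∈ A.vertices, ccw u a < T → ccw u b < T

lemma isCut_one : IsCut 𝓐 u 1 := fun _ _ _ _ _ _ _ => ccw_lt_one _ _

lemma IsCut.of_gap {T h : ℝ} (hT : IsCut 𝓐 u T) (hhT : h ≤ T)
    (hgap : ∀ a ∈ vertexSet 𝓐, ccw u a < T → ccw u a < h) : IsCut 𝓐 u h := fun A hA a ha b hb hah =>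
  hgap b (mem_vertexSet.2 ⟨A, hA, hb⟩) (hT A hA a ha b hb (hah.trans_le hhT))

lemma sees_iff_isCut (hu : u ∉ vertexSet 𝓐) (hw : w ∉ vertexSet 𝓐) :
    Sees 𝓐 u w ↔ IsCut 𝓐 u (ccw u w) := by
  have vertex_ne : ∀ A ∈ 𝓐, ∀ a ∈ A.vertices, 0 < ccw u a ∧ ccw u a ≠ ccw u w := fun A hA a ha =>
    ⟨ccw_pos.2 fun hua => hu (mem_vertexSet.2 ⟨A, hA, hua ▸ ha⟩),
      fun haw => hw (mem_vertexSet.2 ⟨A, hA, ccw_right_injective u haw ▸ ha⟩)⟩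
  constructor
  · intro hsees A hA a ha b hb hlt
    have hx := hsees.2.2 A hA a ha b hb
    have := vertex_ne A hA a ha
    have := vertex_ne A hA b hb
    simp only [Crosses, sbtw_iff_ccw u, ccw_self] at hx
    grind
  · intro hcut
    refine ⟨hu, hw, fun A hA a ha b hb hx => ?_⟩
    have hab := hcut A hA a ha b hb
    have hba := hcut A hA b hb a ha
    have := vertex_ne A hA a ha
    have := vertex_ne A hA b hb
    simp only [Crosses, sbtw_iff_ccw u, ccw_self] at hx
    grind

end Sees

/-! ### Walking along the boundary of the region seen from a point -/

lemma sigma_add_coe_mem_arcIoc {d : ℕ} (hd : 0 < d) {v x y : S} {τ : ℝ} (hτ : 0 < τ)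
    (hv : sigma d v ∈ arcIco x y) (hy : ∀ h, 0 < h → h < τ → sigma d (v + (h : S)) ≠ y) :
    sigma d (v + (τ : S)) ∈ arcIoc x y := by
  have hd' : (0 : ℝ) < d := Nat.cast_pos.2 hd
  set α := ccw x (sigma d v)
  set β := ccw x y with hβ
  have hα0 : 0 ≤ α := ccw_nonneg _ _
  have hβ1 : β < 1 := ccw_lt_one _ _
  have hαβ : α < β := hv
  have sigma_add : ∀ h : ℝ, sigma d (v + (h : S)) = x + ((α + d * h : ℝ) : S) := fun h => by
    rw [sigma_add_coe, AddCircle.coe_add, ← add_assoc, add_ccw]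
  have hle : d * τ ≤ β - α := by
    by_contra! hlt
    refine hy ((β - α) / d) (div_pos (sub_pos.2 hαβ) hd') ((div_lt_iff₀' hd').2 hlt) ?_
    rw [sigma_add, mul_div_cancel₀ _ hd'.ne', add_sub_cancel, hβ, add_ccw]
  have hpos : 0 < d * τ := mul_pos hd' hτ
  have hccw : ccw x (sigma d (v + (τ : S))) = α + d * τ := by
    rw [sigma_add]
    exact ccw_add_coe_of_mem_Ico x ⟨by linarith, by linarith⟩
  constructor <;> linarith

lemma IsSide.ccw_le_of_forall_ccw_le {V : Set S} {t s u : S} (h : IsSide V t s)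
    (hmax : ∀ a ∈ V, ccw u a ≤ ccw u t) {a : S} (ha : a ∈ V) : ccw u s ≤ ccw u a := by
  have hst : ccw u s ≠ ccw u t := fun hst => h.2.2.1 (ccw_right_injective u hst).symm
  have := hmax s h.2.1
  have := h.2.2.2 a ha
  rw [sbtw_iff_ccw u] at this
  grind

lemma IsCut.of_isSide {𝓐 : Set Polygon} (hdisj : 𝓐.Pairwise Polygon.IsDisjoint) {u s t : S} {T : ℝ}
    (hT : IsCut 𝓐 u T) (hmax : ∀ a ∈ vertexSet 𝓐, ccw u a < T → ccw u a ≤ ccw u t)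
    {A : Polygon} (hA : A ∈ 𝓐) (hts : IsSide A.vertices t s) (htT : ccw u t < T) :
    IsCut 𝓐 u (ccw u s) := by
  have last : ∀ B ∈ 𝓐, ∀ a ∈ B.vertices, ccw u a < T → ∀ b ∈ B.vertices, ccw u b ≤ ccw u t :=
    fun B hB a ha haT b hb => hmax b (mem_vertexSet.2 ⟨B, hB, hb⟩) (hT B hB a ha b hb haT)
  have first : ∀ a ∈ A.vertices, ccw u s ≤ ccw u a := fun a ha =>
    hts.ccw_le_of_forall_ccw_le (last A hA t hts.1 htT) ha
  intro B hB a ha b hb has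
  by_contra! hsb
  have hBA : B ≠ A := fun hBA => has.not_ge (first a (hBA ▸ ha))
  have hdj := hdisj hB hA hBA
  have vertex_ne : ∀ c ∈ A.vertices, ccw u c ≠ ccw u b := fun c hc hcb =>
    disjoint_left.1 hdj.1 hb (ccw_right_injective u hcb ▸ hc)
  have hst := first t hts.1
  have hbt := last B hB a ha (by linarith) b hb
  have := vertex_ne s hts.2.1
  have := vertex_ne t hts.1
  refine hdj.2 a ha b hb s hts.2.1 t hts.1 ?_
  simp only [Crosses, sbtw_iff_ccw u]
  grind

section Walk

variable {d : ℕ} {𝓐 : Set Polygon} {u x y : S}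

lemma IsCut.sigma_mem_arcIoc_of_last (hd : 0 < d) (hu : u ∉ vertexSet 𝓐) {T : ℝ} (hT1 : T ≤ 1)
    (hT : IsCut 𝓐 u T) (hy : ∀ w, Sees 𝓐 u w → sigma d w = y → T ≤ ccw u w) {t : S}
    (ht : sigma d t ∈ arcIco x y) (htT : ccw u t < T)
    (hlast : ∀ a ∈ vertexSet 𝓐, ccw u a < T → ccw u a ≤ ccw u t) :
    sigma d (u + (T : S)) ∈ arcIoc x y := by
  have add_eq : ∀ h : ℝ, t + (h : S) = u + ((ccw u t + h : ℝ) : S) := fun h => by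
    rw [AddCircle.coe_add, ← add_assoc, add_ccw]
  have add_sub_eq : t + ((T - ccw u t : ℝ) : S) = u + (T : S) := by rw [add_eq, add_sub_cancel]
  rw [← add_sub_eq]
  refine sigma_add_coe_mem_arcIoc hd (sub_pos.2 htT) ht fun h h0 hh hσ => ?_
  have ccw_add : ccw u (t + (h : S)) = ccw u t + h := by
    rw [add_eq]
    exact ccw_add_coe_of_mem_Ico u ⟨by linarith [ccw_nonneg u t], by linarith⟩
  have hlt : ccw u (t + (h : S)) < T := by linarith
  have not_vertex : t + (h : S) ∉ vertexSet 𝓐 := fun hmem => by linarith [hlast _ hmem hlt]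
  refine (hy _ ((sees_iff_isCut hu not_vertex).2 (hT.of_gap hlt.le fun a ha haT => ?_)) hσ).not_gt
    hlt
  linarith [hlast a ha haT]

-- Walk from `u` to `u + T` counterclockwise along the circle, crossing over each polygon in the way
-- along a side; the last side crossed leads backwards from `s` to `t`. The image of the walk does
-- not leave `[x, y)` before it meets `y`, since sides cannot carry it out of `[x, y)` either.
lemma IsCut.sigma_mem_arcIoc (hd : 0 < d) (hfin : (vertexSet 𝓐).Finite)
    (hdisj : 𝓐.Pairwise Polygon.IsDisjoint) (hu : u ∉ vertexSet 𝓐) (hux : sigma d u ∈ arcIco x y)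
    (hside : ∀ A ∈ 𝓐, ∀ a b, IsSide A.vertices a b → sigma d b ∈ arcIoc x y →
      sigma d a ∈ arcIco x y)
    {T : ℝ} (hT0 : 0 < T) (hT1 : T ≤ 1) (hT : IsCut 𝓐 u T)
    (hy : ∀ w, Sees 𝓐 u w → sigma d w = y → T ≤ ccw u w) :
    sigma d (u + (T : S)) ∈ arcIoc x y := by
  induction hn : {a ∈ vertexSet 𝓐 | ccw u a < T}.ncard using Nat.strong_induction_on
    generalizing T with
  | _ n ih =>
  have hEfin : {a ∈ vertexSet 𝓐 | ccw u a < T}.Finite := hfin.subset (sep_subset _ _)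
  rcases eq_empty_or_nonempty {a ∈ vertexSet 𝓐 | ccw u a < T} with hE | hE
  · refine hT.sigma_mem_arcIoc_of_last hd hu hT1 hy hux (by rwa [ccw_self]) fun a ha haT => ?_
    exact absurd (hE.subset ⟨ha, haT⟩) (notMem_empty a)
  · obtain ⟨t, ⟨ht, htT⟩, hmax⟩ := exists_max_image _ (ccw u) hEfin hE
    obtain ⟨A, hA, htA⟩ := mem_vertexSet.1 ht
    obtain ⟨s, hts⟩ := exists_isSide A.finite A.nontrivial htA
    have hlast : ∀ a ∈ vertexSet 𝓐, ccw u a < T → ccw u a ≤ ccw u t := fun a ha haT =>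
      hmax a ⟨ha, haT⟩
    have hs : s ∈ vertexSet 𝓐 := mem_vertexSet.2 ⟨A, hA, hts.2.1⟩
    have hsT : ccw u s < T := hT A hA t htA s hts.2.1 htT
    have hσs : sigma d (u + (ccw u s : S)) ∈ arcIoc x y := by
      refine ih _ ?_ (ccw_pos.2 fun hus => hu (hus ▸ hs)) (ccw_lt_one u s).le
        (hT.of_isSide hdisj hlast hA hts htT) (fun w hw hwy => hsT.le.trans (hy w hw hwy)) rfl
      rw [← hn]
      exact ncard_lt_ncard ⟨fun a ha => ⟨ha.1, ha.2.trans hsT⟩,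
        fun hsub => lt_irrefl _ (hsub ⟨hs, hsT⟩).2⟩ hEfin
    rw [add_ccw] at hσs
    exact hT.sigma_mem_arcIoc_of_last hd hu hT1 hy (hside A hA t s hts hσs) htT hlast

end Walk

/-! ### Pulling polygons back -/

/-- The polygons of `𝓐` are disjoint, and each of them is mapped onto a polygon of `𝓑` as a
positively oriented covering. -/
structure IsPartialPullback (d : ℕ) (𝓐 𝓑 : Set Polygon) : Prop where
  pairwise_isDisjoint : 𝓐.Pairwise Polygon.IsDisjoint
  covering : ∀ A ∈ 𝓐, A.MapsAsPositiveCovering d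
  image_mem : ∀ A ∈ 𝓐, ∃ B ∈ 𝓑, B.vertices = sigma d '' A.vertices

lemma Polygon.IsDisjoint.mem_arcIco {P Q : Polygon} (h : P.IsDisjoint Q) {x y a b : S}
    (hx : x ∈ Q.vertices) (hy : y ∈ Q.vertices) (ha : a ∈ P.vertices) (hb : b ∈ P.vertices)
    (hbxy : b ∈ arcIoc x y) : a ∈ arcIco x y := by
  have vertex_ne : ∀ p ∈ P.vertices, 0 < ccw x p ∧ ccw x p ≠ ccw x y := fun p hp =>
    ⟨ccw_pos.2 fun hxp => disjoint_left.1 h.1 hp (hxp ▸ hx),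
      fun hpy => disjoint_left.1 h.1 hp (ccw_right_injective x hpy ▸ hy)⟩
  have hx_cross := h.2 a ha b hb x hx y hy
  have := vertex_ne a ha
  have := vertex_ne b hb
  simp only [Crosses, sbtw_iff_ccw x, ccw_self] at hx_cross
  simp only [arcIoc, arcIco, mem_ofPred_eq] at *
  grind

/-- The points over the vertices of `Q` that are seen from `u` past the polygons of `𝓐`: the
vertices of the polygon through `u` that pulls `Q` back. -/
def visibleFiber (d : ℕ) (𝓐 : Set Polygon) (Q : Polygon) (u : S) : Set S :=
  {w | sigma d w ∈ Q.vertices ∧ Sees 𝓐 u w}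

section Pullback

variable {d : ℕ} {𝓐 𝓑 : Set Polygon} {Q : Polygon} {u : S}

lemma finite_visibleFiber (hd : 0 < d) : (visibleFiber d 𝓐 Q u).Finite :=
  (Q.finite.preimage' fun x _ => finite_sigma_fiber hd x).subset fun _ hw => hw.1

lemma visibleFiber_eq_of_mem {v : S} (hv : v ∈ visibleFiber d 𝓐 Q u) :
    visibleFiber d 𝓐 Q v = visibleFiber d 𝓐 Q u :=
  ext fun _ => and_congr_right fun _ => ⟨hv.2.trans, hv.2.symm.trans⟩

namespace IsPartialPullback

lemma sigma_mem_arcIco (h : IsPartialPullback d 𝓐 𝓑) (h𝓑 : 𝓑.Pairwise Polygon.IsDisjoint)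
    (hQ : Q ∈ 𝓑) {A : Polygon} (hA : A ∈ 𝓐) {x y a b : S} (hxy : IsSide Q.vertices x y)
    (hab : IsSide A.vertices a b) (hb : sigma d b ∈ arcIoc x y) : sigma d a ∈ arcIco x y := by
  obtain ⟨B, hB, hBA⟩ := h.image_mem A hA
  have hσab : IsSide B.vertices (sigma d a) (sigma d b) := hBA ▸ h.covering A hA a b hab
  rcases eq_or_ne B Q with rfl | hBQ
  · rw [hxy.eq_of_mem_arcIoc hσab.2.1 hb] at hσab
    rw [hσab.left_unique hxy]
    exact (ccw_self x).trans_lt (ccw_pos.2 hxy.2.2.1)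
  · exact (h𝓑 hB hQ hBQ).mem_arcIco hxy.1 hxy.2.1 hσab.1 hσab.2.1 hb

lemma sigma_add_coe_mem_arcIoc (hd : 0 < d) (h : IsPartialPullback d 𝓐 𝓑)
    (hfin : (vertexSet 𝓐).Finite) (h𝓑 : 𝓑.Pairwise Polygon.IsDisjoint) (hQ : Q ∈ 𝓑)
    (hu : u ∉ vertexSet 𝓐) {y : S} (hy : IsSide Q.vertices (sigma d u) y) {T : ℝ} (hT0 : 0 < T)
    (hT1 : T ≤ 1) (hT : IsCut 𝓐 u T)
    (hfree : ∀ w ∈ visibleFiber d 𝓐 Q u, w ≠ u → T ≤ ccw u w) :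
    sigma d (u + (T : S)) ∈ arcIoc (sigma d u) y := by
  refine hT.sigma_mem_arcIoc hd hfin h.pairwise_isDisjoint hu
    ((ccw_self _).trans_lt (ccw_pos.2 hy.2.2.1))
    (fun A hA a b => h.sigma_mem_arcIco h𝓑 hQ hA hy) hT0 hT1 fun w hw hwy => ?_
  exact hfree w ⟨hwy ▸ hy.2.1, hw⟩ fun hwu => hy.2.2.1 (hwu ▸ hwy)

-- A walk all around the circle without meeting a point over a vertex of `Q` would stay in the
-- preimage of `(x, y]`, where `x` is the image of its endpoint `u`.
lemma nontrivial_visibleFiber (hd : 0 < d) (h : IsPartialPullback d 𝓐 𝓑)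
    (hfin : (vertexSet 𝓐).Finite) (h𝓑 : 𝓑.Pairwise Polygon.IsDisjoint) (hQ : Q ∈ 𝓑)
    (huQ : sigma d u ∈ Q.vertices) (hu : u ∉ vertexSet 𝓐) :
    (visibleFiber d 𝓐 Q u).Nontrivial := by
  by_contra hnot
  rw [not_nontrivial_iff] at hnot
  obtain ⟨y, hy⟩ := exists_isSide Q.finite Q.nontrivial huQ
  have mem_arc := h.sigma_add_coe_mem_arcIoc hd hfin h𝓑 hQ hu hy one_pos le_rfl isCut_one
    fun w hw hwu => absurd (hnot hw ⟨huQ, Sees.refl hu⟩) hwu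
  rw [AddCircle.coe_period, add_zero] at mem_arc
  exact mem_arc.1.ne' (ccw_self _)

lemma isSide_sigma_of_isSide_visibleFiber (hd : 0 < d) (h : IsPartialPullback d 𝓐 𝓑)
    (hfin : (vertexSet 𝓐).Finite) (h𝓑 : 𝓑.Pairwise Polygon.IsDisjoint) (hQ : Q ∈ 𝓑) {a b : S}
    (hab : IsSide (visibleFiber d 𝓐 Q u) a b) : IsSide Q.vertices (sigma d a) (sigma d b) := by
  obtain ⟨y, hy⟩ := exists_isSide Q.finite Q.nontrivial hab.1.1
  have hsees : Sees 𝓐 a b := hab.1.2.symm.trans hab.2.1.2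
  have mem_arc := h.sigma_add_coe_mem_arcIoc hd hfin h𝓑 hQ hsees.1 hy (ccw_pos.2 hab.2.2.1)
    (ccw_lt_one a b).le ((sees_iff_isCut hsees.1 hsees.2.1).1 hsees) fun w hw hwa => by
      by_contra! hlt
      exact hwa (hab.eq_of_mem_arcIco (visibleFiber_eq_of_mem hab.1 ▸ hw) hlt)
  rw [add_ccw] at mem_arc
  exact hy.eq_of_mem_arcIoc hab.2.1.1 mem_arc ▸ hy

lemma image_visibleFiber (hd : 0 < d) (h : IsPartialPullback d 𝓐 𝓑)
    (hfin : (vertexSet 𝓐).Finite) (h𝓑 : 𝓑.Pairwise Polygon.IsDisjoint) (hQ : Q ∈ 𝓑)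
    (huQ : sigma d u ∈ Q.vertices) (hu : u ∉ vertexSet 𝓐) :
    sigma d '' visibleFiber d 𝓐 Q u = Q.vertices := by
  have hsub : sigma d '' visibleFiber d 𝓐 Q u ⊆ Q.vertices := image_subset_iff.2 fun w hw => hw.1
  refine hsub.antisymm (subset_of_isSide_closed Q.finite Q.nontrivial hsub
    ⟨_, mem_image_of_mem _ ⟨huQ, Sees.refl hu⟩⟩ ?_)
  rintro _ y ⟨v, hv, rfl⟩ hy
  obtain ⟨w, hw⟩ := exists_isSide (finite_visibleFiber hd)
    (h.nontrivial_visibleFiber hd hfin h𝓑 hQ huQ hu) hv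
  exact ⟨w, hw.2.1, (h.isSide_sigma_of_isSide_visibleFiber hd hfin h𝓑 hQ hw).right_unique hy⟩

lemma exists_insert (hd : 0 < d) (h : IsPartialPullback d 𝓐 𝓑) (hfin : (vertexSet 𝓐).Finite)
    (h𝓑 : 𝓑.Pairwise Polygon.IsDisjoint) (huσ : sigma d u ∈ vertexSet 𝓑) (hu : u ∉ vertexSet 𝓐) :
    ∃ P : Polygon, u ∈ P.vertices ∧ IsPartialPullback d (insert P 𝓐) 𝓑 := by
  obtain ⟨Q, hQ, huQ⟩ := mem_vertexSet.1 huσ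
  have image_eq := h.image_visibleFiber hd hfin h𝓑 hQ huQ hu
  let P : Polygon := ⟨visibleFiber d 𝓐 Q u, finite_visibleFiber hd,
    h.nontrivial_visibleFiber hd hfin h𝓑 hQ huQ hu⟩
  have isDisjoint : ∀ A ∈ 𝓐, P ≠ A → P.IsDisjoint A := fun A hA _ => by
    refine ⟨disjoint_left.2 fun v hv hvA => hv.2.2.1 (mem_vertexSet.2 ⟨A, hA, hvA⟩), ?_⟩
    intro a ha b hb c hc e he hx
    exact (ha.2.symm.trans hb.2).2.2 A hA c hc e he hx.symm
  refine ⟨P, ⟨huQ, Sees.refl hu⟩, (pairwise_insert_of_symm).2 ⟨h.pairwise_isDisjoint, isDisjoint⟩,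
    forall_mem_insert.2 ⟨fun a b hab => ?_, h.covering⟩,
    forall_mem_insert.2 ⟨⟨Q, hQ, image_eq.symm⟩, h.image_mem⟩⟩
  rw [image_eq]
  exact h.isSide_sigma_of_isSide_visibleFiber hd hfin h𝓑 hQ hab

lemma exists_superset_of_finite (hd : 0 < d) (h : IsPartialPullback d 𝓐 𝓑)
    (hfin : (vertexSet 𝓐).Finite) (h𝓑 : 𝓑.Pairwise Polygon.IsDisjoint) {U : Set S} (hU : U.Finite)
    (hUσ : U ⊆ sigma d ⁻¹' vertexSet 𝓑) :
    ∃ 𝓐', 𝓐 ⊆ 𝓐' ∧ IsPartialPullback d 𝓐' 𝓑 ∧ (vertexSet 𝓐').Finite ∧ U ⊆ vertexSet 𝓐' := by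
  induction U, hU using Set.Finite.induction_on with
  | empty => exact ⟨𝓐, Subset.rfl, h, hfin, empty_subset _⟩
  | @insert u U _ _ ih =>
    obtain ⟨huσ, hUσ⟩ := insert_subset_iff.1 hUσ
    obtain ⟨𝓐', hsub, h', hfin', hU'⟩ := ih hUσ
    by_cases hu : u ∈ vertexSet 𝓐'
    · exact ⟨𝓐', hsub, h', hfin', insert_subset hu hU'⟩
    · obtain ⟨P, huP, hP⟩ := h'.exists_insert hd hfin' h𝓑 huσ hu
      have vertexSet_insert : vertexSet (insert P 𝓐') = P.vertices ∪ vertexSet 𝓐' :=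
        biUnion_insert _ _ _
      refine ⟨insert P 𝓐', hsub.trans (subset_insert _ _), hP, ?_, ?_⟩
      · exact vertexSet_insert ▸ P.finite.union hfin'
      · exact vertexSet_insert ▸ insert_subset (Or.inl huP) (hU'.trans subset_union_right)

lemma mono_right {𝓒 : Set Polygon} (h : IsPartialPullback d 𝓐 𝓑) (hsub : 𝓑 ⊆ 𝓒) :
    IsPartialPullback d 𝓐 𝓒 where
  pairwise_isDisjoint := h.pairwise_isDisjoint
  covering := h.covering
  image_mem A hA := (h.image_mem A hA).imp fun _ hB => ⟨hsub hB.1, hB.2⟩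

end IsPartialPullback

/-- `G` consists of disjoint polygons, is mapped to itself by positively oriented coverings, and its
set of vertices is backward invariant. -/
structure CompletelyInvariant (d : ℕ) (G : Set Polygon) : Prop
    extends IsPartialPullback d G G where
  preimage_subset : sigma d ⁻¹' vertexSet G ⊆ vertexSet G

lemma IsPartialPullback.exists_step (hd : 0 < d) (h : IsPartialPullback d 𝓐 𝓐)
    (hfin : (vertexSet 𝓐).Finite) :
    ∃ 𝓐', 𝓐 ⊆ 𝓐' ∧ IsPartialPullback d 𝓐' 𝓐' ∧ (vertexSet 𝓐').Finite ∧
      sigma d ⁻¹' vertexSet 𝓐 ⊆ vertexSet 𝓐' := by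
  obtain ⟨𝓐', hsub, h', hfin', hpre⟩ := h.exists_superset_of_finite hd hfin h.pairwise_isDisjoint
    (hfin.preimage' fun x _ => finite_sigma_fiber hd x) Subset.rfl
  exact ⟨𝓐', hsub, h'.mono_right hsub, hfin', hpre⟩

theorem IsPartialPullback.exists_completelyInvariant (hd : 0 < d) (h : IsPartialPullback d 𝓐 𝓐)
    (hfin : (vertexSet 𝓐).Finite) : ∃ G, 𝓐 ⊆ G ∧ CompletelyInvariant d G := by
  let Stage := {𝓒 : Set Polygon // IsPartialPullback d 𝓒 𝓒 ∧ (vertexSet 𝓒).Finite}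
  have exists_next : ∀ X : Stage, ∃ Y : Stage, X.1 ⊆ Y.1 ∧
      sigma d ⁻¹' vertexSet X.1 ⊆ vertexSet Y.1 := fun X => by
    obtain ⟨𝓒, hsub, h𝓒, hfin𝓒, hpre⟩ := X.2.1.exists_step hd X.2.2
    exact ⟨⟨𝓒, h𝓒, hfin𝓒⟩, hsub, hpre⟩
  choose next hsub hpre using exists_next
  let X : ℕ → Stage := fun n => next^[n] ⟨𝓐, h, hfin⟩
  have X_succ : ∀ n, X (n + 1) = next (X n) := fun n => Function.iterate_succ_apply' next n _
  have hmono : Monotone fun n => (X n).1 := monotone_nat_of_le_succ fun n => by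
    simpa only [X_succ] using hsub (X n)
  have X_subset : ∀ n, (X n).1 ⊆ ⋃ n, (X n).1 := subset_iUnion fun n => (X n).1
  refine ⟨⋃ n, (X n).1, X_subset 0, ⟨?_, ?_, ?_⟩, fun u hu => ?_⟩
  · exact (pairwise_iUnion hmono.directed_le).2 fun n => (X n).2.1.pairwise_isDisjoint
  · rintro P hP
    obtain ⟨n, hP⟩ := mem_iUnion.1 hP
    exact (X n).2.1.covering P hP
  · rintro P hP
    obtain ⟨n, hP⟩ := mem_iUnion.1 hP
    exact ((X n).2.1.mono_right (X_subset n)).image_mem P hP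
  · obtain ⟨Q, hQ, huQ⟩ := mem_vertexSet.1 hu
    obtain ⟨n, hQ⟩ := mem_iUnion.1 hQ
    refine vertexSet_mono (X_subset (n + 1)) (X_succ n ▸ hpre (X n) ?_)
    exact mem_vertexSet.2 ⟨Q, hQ, huQ⟩

end Pullback

/-! ### Laminations generated by directed chords -/

/-- The undirected chord of a directed chord `p`, which is encoded by its origin and its end. -/
def chord (p : S × S) : Sym2 S := s(p.1, p.2)

lemma chord_eq_chord {p q : S × S} : chord p = chord q ↔ p = q ∨ p = q.swap := by
  simp only [chord, Sym2.eq_iff, Prod.ext_iff, Prod.fst_swap, Prod.snd_swap]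

lemma chord_mem_image {E : Set (S × S)} {p : S × S} :
    chord p ∈ chord '' E ↔ p ∈ E ∨ p.swap ∈ E := by
  simp only [mem_image, chord_eq_chord, and_or_left, exists_or, exists_eq_right]

lemma crosses_congr_chord {p p' q q' : S × S} (hp : chord p = chord p') (hq : chord q = chord q')
    (h : Crosses p.1 p.2 q.1 q.2) : Crosses p'.1 p'.2 q'.1 q'.2 := by
  rcases chord_eq_chord.1 hp with rfl | rfl <;> rcases chord_eq_chord.1 hq with rfl | rfl
  exacts [h, h.swap_right, h.swap_left, h.swap_left.swap_right]

lemma ne_of_crosses {a b c e : S} (h : Crosses a b c e) : a ≠ b :=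
  h.elim (fun h => (ne_of_sbtw h.1).2.2) fun h => (ne_of_sbtw h.1).2.2

lemma closure_not_crosses {E : Set (S × S)} (hE : ∀ p ∈ E, ∀ q ∈ E, ¬ Crosses p.1 p.2 q.1 q.2)
    {p q : S × S} (hp : p ∈ closure E) (hq : q ∈ closure E) : ¬ Crosses p.1 p.2 q.1 q.2 := by
  intro hx
  have hpq : (p, q) ∈ closure (E ×ˢ E) := by
    rw [closure_prod_eq]
    exact ⟨hp, hq⟩
  obtain ⟨r, hr, hrE⟩ := mem_closure_iff.1 hpq _ isOpen_crosses hx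
  exact hE _ hrE.1 _ hrE.2 hr

/-- The lamination generated by the directed chords of `E`: the points of the circle and the limits
of chords of `E`. -/
def Lamination.generatedBy (E : Set (S × S))
    (hE : ∀ p ∈ E, ∀ q ∈ E, ¬ Crosses p.1 p.2 q.1 q.2) : Lamination where
  chords := {l | l.IsDiag} ∪ chord '' closure E
  closed := by
    have eq_union : {p : S × S | s(p.1, p.2) ∈ {l : Sym2 S | l.IsDiag} ∪ chord '' closure E} =
        {p | p.1 = p.2} ∪ (closure E ∪ Prod.swap ⁻¹' closure E) := by
      ext p
      exact or_congr Iff.rfl chord_mem_image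
    rw [eq_union]
    exact (isClosed_eq continuous_fst continuous_snd).union
      (isClosed_closure.union (isClosed_closure.preimage continuous_swap))
  point_mem x := Or.inl rfl
  not_crosses a b c e hab hce hx := by
    obtain ⟨p, hp, hpl⟩ := hab.resolve_left (ne_of_crosses hx)
    obtain ⟨q, hq, hql⟩ := hce.resolve_left (ne_of_crosses hx.symm)
    exact closure_not_crosses hE hp hq
      (crosses_congr_chord (p := (a, b)) (q := (c, e)) hpl.symm hql.symm hx)

/-- `E` is a family of non-crossing directed chords, at most one issuing from and at most one ending
at any given point, that is mapped to itself by `sigma d`, and each chord of which lifts to a chord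
of `E` from any point over its origin. -/
structure InvariantChords (d : ℕ) (E : Set (S × S)) : Prop where
  not_crosses : ∀ p ∈ E, ∀ q ∈ E, ¬ Crosses p.1 p.2 q.1 q.2
  right_unique : ∀ {a b c}, (a, b) ∈ E → (a, c) ∈ E → b = c
  left_unique : ∀ {a b c}, (a, c) ∈ E → (b, c) ∈ E → a = b
  image_mem : MapsTo (Prod.map (sigma d) (sigma d)) E E
  exists_lift : ∀ {w b}, (sigma d w, b) ∈ E → ∃ c, (w, c) ∈ E ∧ sigma d c = b

namespace InvariantChords

variable {d : ℕ} {E : Set (S × S)}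

lemma exists_preimage_mem_closure (hd : 0 < d) (hE : InvariantChords d E) {p : S × S}
    (hp : p ∈ closure E) : ∃ q ∈ closure E, Prod.map (sigma d) (sigma d) q = p := by
  have isClosed_image : IsClosed (Prod.map (sigma d) (sigma d) '' closure E) :=
    (isClosed_closure.isCompact.image
      ((continuous_sigma d).prodMap (continuous_sigma d))).isClosed
  refine closure_minimal ?_ isClosed_image hp
  rintro ⟨a, b⟩ hab
  obtain ⟨w, rfl⟩ := sigma_surjective hd a
  obtain ⟨c, hc, rfl⟩ := hE.exists_lift hab
  exact ⟨(w, c), subset_closure hc, rfl⟩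

/-- `m` lists `d` directed chords of `closure E` with a common image, which match the fibre over its
origin with the fibre over its end: the siblings that an invariant lamination must contain. -/
structure IsSiblingFamily (d : ℕ) (E : Set (S × S)) (m : Fin d → S × S) : Prop where
  mem_closure : ∀ k, m k ∈ closure E
  isFiber_fst : IsFiber d fun k => (m k).1
  isFiber_snd : IsFiber d fun k => (m k).2

lemma isClosed_isSiblingFamily (hd : 0 < d) (E : Set (S × S)) :
    IsClosed {m | IsSiblingFamily d E m} := by
  have eq_inter : {m | IsSiblingFamily d E m} = (⋂ k, (fun m => m k) ⁻¹' closure E) ∩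
      ((fun m k => (m k).1) ⁻¹' {v | IsFiber d v} ∩ (fun m k => (m k).2) ⁻¹' {v | IsFiber d v}) :=
    ext fun m => ⟨fun h => ⟨mem_iInter.2 h.1, h.2, h.3⟩, fun h => ⟨mem_iInter.1 h.1, h.2.1, h.2.2⟩⟩
  rw [eq_inter]
  exact (isClosed_iInter fun k => isClosed_closure.preimage (continuous_apply k)).inter
    (((isClosed_isFiber hd).preimage (by fun_prop)).inter
      ((isClosed_isFiber hd).preimage (by fun_prop)))

lemma exists_isSiblingFamily_of_mem (hd : 0 < d) (hE : InvariantChords d E) {p : S × S}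
    (hp : p ∈ E) : ∃ m, IsSiblingFamily d E m ∧ p ∈ range m := by
  obtain ⟨v, hv, k₀, hk₀⟩ := exists_isFiber hd p.1
  have image_mem : ∀ k, (sigma d (v k), sigma d p.2) ∈ E := fun k => by
    rw [hv.sigma_eq k k₀, hk₀]
    exact hE.image_mem hp
  choose c hc hσc using fun k => hE.exists_lift (image_mem k)
  refine ⟨fun k => (v k, c k), ⟨fun k => subset_closure (hc k), hv,
    fun k l => (hσc k).trans (hσc l).symm, fun k l hkl => ?_⟩, k₀, Prod.ext hk₀ ?_⟩
  · have hkl : c k = c l := hkl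
    exact hv.injective (hE.left_unique (hc k) (hkl ▸ hc l))
  · exact hE.right_unique (hc k₀) (hk₀ ▸ hp)

lemma exists_isSiblingFamily (hd : 0 < d) (hE : InvariantChords d E) {p : S × S}
    (hp : p ∈ closure E) : ∃ m, IsSiblingFamily d E m ∧ p ∈ range m := by
  have isClosed_union : IsClosed (⋃ k, (fun m => m k) '' {m | IsSiblingFamily d E m}) :=
    isClosed_iUnion_of_finite fun k =>
      ((isClosed_isSiblingFamily hd E).isCompact.image (continuous_apply k)).isClosed
  have mem_union := closure_minimal (fun q hq => ?_) isClosed_union hp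
  · obtain ⟨k, m, hm, hk⟩ := mem_iUnion.1 mem_union
    exact ⟨m, hm, k, hk⟩
  · obtain ⟨m, hm, k, hk⟩ := hE.exists_isSiblingFamily_of_mem hd hq
    exact mem_iUnion.2 ⟨k, m, hm, hk⟩

lemma IsSiblingFamily.disjoint {m : Fin d → S × S} (hm : IsSiblingFamily d E m) {i j : Fin d}
    (hne : sigma d (m i).1 ≠ sigma d (m i).2) (hij : i ≠ j) (x : S) :
    ¬ (x ∈ chord (m i) ∧ x ∈ chord (m j)) := by
  rintro ⟨hi, hj⟩
  have h₁ := hm.isFiber_fst.sigma_eq i j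
  have h₂ := hm.isFiber_snd.sigma_eq i j
  rcases Sym2.mem_iff.1 hi with rfl | rfl <;> rcases Sym2.mem_iff.1 hj with h | h
  · exact hij (hm.isFiber_fst.injective h)
  · exact hne (h₂ ▸ h ▸ rfl)
  · exact hne (h₁ ▸ h ▸ rfl)
  · exact hij (hm.isFiber_snd.injective h)

theorem isInvariant_generatedBy (hd : 0 < d) (hE : InvariantChords d E) :
    (Lamination.generatedBy E hE.not_crosses).IsInvariant d where
  image_mem := by
    rintro l (hl | ⟨p, hp, rfl⟩)
    · exact Or.inr hl.map
    · exact Or.inl (Or.inr ⟨_, map_mem_closure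
        ((continuous_sigma d).prodMap (continuous_sigma d)) hp hE.image_mem, rfl⟩)
  exists_preimage := by
    rintro l (hl | ⟨p, hp, rfl⟩)
    · induction l using Sym2.ind with
      | _ a b =>
        obtain rfl : a = b := hl
        obtain ⟨w, rfl⟩ := sigma_surjective hd a
        exact ⟨s(w, w), Or.inl rfl, rfl⟩
    · obtain ⟨q, hq, rfl⟩ := hE.exists_preimage_mem_closure hd hp
      exact ⟨chord q, Or.inr ⟨q, hq, rfl⟩, rfl⟩
  exists_siblings := by
    rintro l (hl | ⟨p, hp, rfl⟩) hne
    · exact absurd hl.map hne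
    obtain ⟨m, hm, k, rfl⟩ := hE.exists_isSiblingFamily hd hp
    have sigmaChord_eq : ∀ i j, sigmaChord d (chord (m i)) = sigmaChord d (chord (m j)) :=
      fun i j => congrArg₂ Sym2.mk (hm.isFiber_fst.sigma_eq i j) (hm.isFiber_snd.sigma_eq i j)
    refine ⟨chord ∘ m, ⟨k, rfl⟩, fun i => ⟨Or.inr ⟨m i, hm.mem_closure i, rfl⟩,
      sigmaChord_eq i k⟩, fun i j hij => hm.disjoint ?_ hij⟩
    exact (sigmaChord_eq i k ▸ hne :)

end InvariantChords

/-! ### The lamination of a completely invariant set of polygons -/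

/-- The directed sides of the polygons of `G`. -/
def directedSides (G : Set Polygon) : Set (S × S) := {p | ∃ P ∈ G, IsSide P.vertices p.1 p.2}

section DirectedSides

variable {d : ℕ} {G : Set Polygon}

lemma eq_of_mem_vertices (hdisj : G.Pairwise Polygon.IsDisjoint) {P Q : Polygon} (hP : P ∈ G)
    (hQ : Q ∈ G) {a : S} (haP : a ∈ P.vertices) (haQ : a ∈ Q.vertices) : P = Q :=
  hdisj.eq hP hQ fun h => disjoint_left.1 h.1 haP haQ

lemma not_crosses_of_mem_directedSides (hdisj : G.Pairwise Polygon.IsDisjoint) {Q : Polygon}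
    (hQ : Q ∈ G) {p : S × S} (hp : p ∈ directedSides G) {c e : S} (hc : c ∈ Q.vertices)
    (he : e ∈ Q.vertices) : ¬ Crosses p.1 p.2 c e := by
  obtain ⟨P, hP, hp⟩ := hp
  rcases eq_or_ne P Q with rfl | hPQ
  · exact fun hx => hx.elim (fun h => hp.2.2.2 c hc h.1) fun h => hp.2.2.2 e he h.1
  · exact (hdisj hP hQ hPQ).2 _ hp.1 _ hp.2.1 c hc e he

lemma CompletelyInvariant.invariantChords (hG : CompletelyInvariant d G) :
    InvariantChords d (directedSides G) where
  not_crosses p hp q := fun ⟨_, hQ, hq⟩ =>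
    not_crosses_of_mem_directedSides hG.pairwise_isDisjoint hQ hp hq.1 hq.2.1
  right_unique := fun ⟨P, hP, hab⟩ ⟨Q, hQ, hac⟩ => by
    obtain rfl := eq_of_mem_vertices hG.pairwise_isDisjoint hP hQ hab.1 hac.1
    exact hab.right_unique hac
  left_unique := fun ⟨P, hP, hac⟩ ⟨Q, hQ, hbc⟩ => by
    obtain rfl := eq_of_mem_vertices hG.pairwise_isDisjoint hP hQ hac.2.1 hbc.2.1
    exact hac.left_unique hbc
  image_mem := fun p ⟨P, hP, hp⟩ => by
    obtain ⟨Q, hQ, hQP⟩ := hG.image_mem P hP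
    exact ⟨Q, hQ, hQP ▸ hG.covering P hP _ _ hp⟩
  exists_lift := fun {w b} ⟨P, hP, hab⟩ => by
    obtain ⟨R, hR, hwR⟩ := mem_vertexSet.1 (hG.preimage_subset (mem_vertexSet.2 ⟨P, hP, hab.1⟩))
    obtain ⟨c, hc⟩ := exists_isSide R.finite R.nontrivial hwR
    obtain ⟨Q, hQ, hQR⟩ := hG.image_mem R hR
    have hσwc : IsSide Q.vertices (sigma d w) (sigma d c) := hQR ▸ hG.covering R hR _ _ hc
    obtain rfl := eq_of_mem_vertices hG.pairwise_isDisjoint hQ hP hσwc.1 hab.1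
    exact ⟨c, ⟨R, hR, hc⟩, hσwc.right_unique hab⟩

lemma isSide_or_isSide_of_mem_closure (hdisj : G.Pairwise Polygon.IsDisjoint) {P : Polygon}
    (hP : P ∈ G) {a b : S} (ha : a ∈ P.vertices) (hb : b ∈ P.vertices) (hab : a ≠ b)
    (hmem : (a, b) ∈ closure (directedSides G)) :
    IsSide P.vertices a b ∨ IsSide P.vertices b a := by
  by_contra! hdiag
  obtain ⟨c, hc, hacb⟩ : ∃ c ∈ P.vertices, sbtw a c b := by
    by_contra! hside
    exact hdiag.1 ⟨ha, hb, hab, hside⟩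
  obtain ⟨e, he, hbea⟩ : ∃ e ∈ P.vertices, sbtw b e a := by
    by_contra! hside
    exact hdiag.2 ⟨hb, ha, hab.symm, hside⟩
  have isOpen_crosses_ce : IsOpen {p : S × S | Crosses p.1 p.2 c e} :=
    isOpen_crosses.preimage (f := fun p : S × S => (p, (c, e))) (by fun_prop)
  obtain ⟨p, hx, hp⟩ := mem_closure_iff.1 hmem _ isOpen_crosses_ce (Or.inl ⟨hacb, hbea⟩)
  exact not_crosses_of_mem_directedSides hdisj hP hp hc he hx

lemma CompletelyInvariant.hasPolygon_generatedBy (hG : CompletelyInvariant d G) {P : Polygon}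
    (hP : P ∈ G) :
    (Lamination.generatedBy _ hG.invariantChords.not_crosses).HasPolygon P := by
  have isSide_or := @isSide_or_isSide_of_mem_closure G hG.pairwise_isDisjoint P hP
  intro a ha b hb hab
  constructor
  · rintro (h | ⟨p, hp, hpab⟩)
    · exact absurd h hab
    · rcases (chord_eq_chord (q := (a, b))).1 hpab with rfl | rfl
      · exact isSide_or ha hb hab hp
      · exact (isSide_or hb ha hab.symm hp).symm
  · rintro (h | h)
    · exact Or.inr ⟨(a, b), subset_closure ⟨P, hP, h⟩, rfl⟩
    · exact Or.inr ⟨(b, a), subset_closure ⟨P, hP, h⟩, Sym2.eq_swap⟩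

end DirectedSides

end Lam

theorem mainTheorem1 (d : ℕ) (hd : 2 ≤ d) (F : Set Lam.Polygon) (hfin : F.Finite)
    (hdisj : ∀ P ∈ F, ∀ Q ∈ F, P ≠ Q → P.IsDisjoint Q)
    (hinv : Lam.ForwardInvariant d F) :
    (∃ L : Lam.Lamination, L.IsInvariant d ∧ ∀ P ∈ F, L.HasPolygon P) ↔
      ∀ P ∈ F, P.MapsAsPositiveCovering d := by
  have hd0 : 0 < d := by lia
  constructor
  · rintro ⟨L, hL, hF⟩ P hP
    obtain ⟨hside, Q, hQ, hQP⟩ := hinv P hP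
    exact (hF P hP).mapsAsPositiveCovering (hF Q hQ) hL hQP hside
  · intro hcov
    have isPartialPullback : Lam.IsPartialPullback d F F :=
      ⟨fun P hP Q hQ => hdisj P hP Q hQ, hcov, fun P hP => (hinv P hP).2⟩
    obtain ⟨G, hFG, hG⟩ :=
      isPartialPullback.exists_completelyInvariant hd0 (hfin.biUnion fun P _ => P.finite)
    exact ⟨_, hG.invariantChords.isInvariant_generatedBy hd0,
      fun P hP => hG.hasPolygon_generatedBy (hFG hP)⟩
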